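/- Let $n\ge 1$ be an integer, $\omega>0$, $s>\frac n2$ and $0<\sigma<\frac{2s}{n}-1$. With $\hat f(\xi)=\int_{\mathbf R^n} f(x)e^{-2\pi i x\cdot\xi}\,dx$ and $\widehat{(-\Delta)^{a}f}(\xi)=(2\pi|\xi|)^{2a}\hat f(\xi)$, let $H^s=H^s(\mathbf R^n)$ be the space of $f\in L^2$ (identified with their continuous representatives) such that $(-\Delta)^{s/2}f\in L^2$, with norm $\|f\|_{H^s}=\|(-\Delta)^{s/2}f\|_{L^2}+\|f\|_{L^2}$. Consider the concentrated nonlinear Schrödinger equation $$ i u_t=\big((-\Delta)^s-|u|^{2\sigma}\delta_0\big)u,\qquad u(0,\cdot)=u_0 . \tag{1}$$ A solution of (1) with datum $u_0\in H^s$ on a time interval $I\ni 0$, $I\subset[0,\infty)$, is a function $u\in C(I;H^s)$ with $u(0)=u_0$ such that for all $t\in I$ and all $\psi\in C_c^\infty(\mathbf R\times\mathbf R^n)$, with $\langle f,g\rangle=\int f\bar g$, $$ i\Big(\langle u(t),\psi(t)\rangle-\langle u_0,\psi(0)\rangle-\int_0^t\langle u,\psi_\tau\rangle d\tau\Big)=\int_0^t\langle(-\Delta)^{s/2}u,(-\Delta)^{s/2}\psi\rangle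 d\tau-\int_0^t|u(\tau,0)|^{2\sigma}u(\tau,0)\overline{\psi(\tau,0)}\,d\tau .$$ Let $M(f)=\int|f|^2$, $E(f)=\frac12\|(-\Delta)^{s/2}f\|_{L^2}^2-\frac1{2\sigma+2}|f(0)|^{2\sigma+2}$, and let $\phi_\omega\in H^s$ be the profile with $$\hat\phi_\omega(\xi)=\Big(\int_{\mathbf R^n}\frac{d\eta}{(2\pi|\eta|)^{2s}+\omega}\Big)^{-(1+\frac1{2\sigma})}\frac1{(2\pi|\xi|)^{2s}+\omega}.$$ Let $g\mapsto u_g$ be a solution map for (1) which satisfies the following two assumptions. 1. (Continuous dependence at $\phi_\omega$.) There is $T_0>0$ such that for every $\epsilon>0$ there is $\delta>0$ such that for every $g\in H^s$ with $\|g-\phi_\omega\|_{H^s}<\delta$, $u_g$ is a solution of (1) with datum $g$ on $[0,T_0)$ and $\sup_{0<t<T_0}\|u_g(t)-e^{i\omega t}\phi_\omega\|_{H^s}<\epsilon$. 2. (Global existence and conservation laws near $\phi_\omega$.) There is $r>0$ such that for every $g\in H^s$ with $\|g-\phi_\omega\|_{H^s}<r$, $u_g$ is a solution of (1) with datum $g$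 on $[0,\infty)$, and $M(u_g(t))=M(g)$, $E(u_g(t))=E(g)$ for all $t\ge0$. Then $e^{i\omega t}\phi_\omega$ is orbitally stable in $H^s$: for every $\epsilon>0$ there is $\delta>0$ such that for every $g\in H^s$ with $\|g-\phi_\omega\|_{H^s}<\delta$, $u_g$ is a solution of (1) with datum $g$ on $[0,\infty)$, in particular $u_g(t)\in H^s$ for all $t\ge0$, and $$\sup_{t>0}\ \inf_{\theta\in\mathbf R}\ \|u_g(t)-e^{i(\omega t+\theta)}\phi_\omega\|_{H^s}<\epsilon .$$ -/

import Mathlib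

open MeasureTheory Set Filter Topology FourierTransform
open scoped ENNReal ComplexConjugate

namespace ConcNLS

noncomputable section

/-- The space `ℝⁿ` with its Euclidean norm and Lebesgue measure. -/
abbrev Rn (n : ℕ) : Type := EuclideanSpace ℝ (Fin n)

/-- The Fourier transform on `L²(ℝⁿ)`, with the convention
`f̂(ξ) = ∫ f(x) e^{-2πi x·ξ} dx`; it is set to `0` outside `L²`. -/
def l2Fourier {n : ℕ} (f : Rn n → ℂ) : Rn n → ℂ :=
  open Classical in
  if h : MemLp f 2 volume then ⇑(𝓕 (h.toLp f) : Lp ℂ 2 (volume : Measure (Rn n))) else 0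

/-- `ξ ↦ (2π|ξ|)^{2a} f̂(ξ)`, the Fourier transform of `(-Δ)^a f`. -/
def fracLapHat {n : ℕ} (a : ℝ) (f : Rn n → ℂ) (ξ : Rn n) : ℂ :=
  (((2 * Real.pi * ‖ξ‖) ^ (2 * a) : ℝ) : ℂ) * l2Fourier f ξ

/-- The fractional Laplacian `(-Δ)^a f` as an element of `L²(ℝⁿ)`: the Fourier multiplier with
symbol `(2π|ξ|)^{2a}` (set to `0` where the result is not in `L²`). -/
def fracLap {n : ℕ} (a : ℝ) (f : Rn n → ℂ) : Lp ℂ 2 (volume : Measure (Rn n)) :=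
  open Classical in
  if h : MemLp (fracLapHat a f) 2 volume then 𝓕⁻ (h.toLp (fracLapHat a f)) else 0

/-- `f` is (the continuous representative of) an element of `H^s(ℝⁿ)`: `f` is continuous,
`f ∈ L²` and `(-Δ)^{s/2} f ∈ L²`. -/
def MemHs {n : ℕ} (s : ℝ) (f : Rn n → ℂ) : Prop :=
  Continuous f ∧ MemLp f 2 volume ∧ MemLp (fracLapHat (s / 2) f) 2 volume

/-- The norm `‖f‖_{H^s} = ‖(-Δ)^{s/2} f‖_{L²} + ‖f‖_{L²}`, used for `f ∈ H^s`. -/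
def hsNorm {n : ℕ} (s : ℝ) (f : Rn n → ℂ) : ℝ :=
  ‖fracLap (s / 2) f‖ + (eLpNorm f 2 volume).toReal

/-- The pairing `⟨f, g⟩ = ∫ f ḡ dx`. -/
def pair {n : ℕ} (f g : Rn n → ℂ) : ℂ := ∫ x, f x * conj (g x)

/-- The mass `M(f) = ∫ |f|² dx`. -/
def mass {n : ℕ} (f : Rn n → ℂ) : ℝ := ∫ x, ‖f x‖ ^ 2

/-- The energy `E(f) = ½ ‖(-Δ)^{s/2} f‖² - (2σ+2)⁻¹ |f(0)|^{2σ+2}`. -/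
def energy {n : ℕ} (s σ : ℝ) (f : Rn n → ℂ) : ℝ :=
  1 / 2 * ‖fracLap (s / 2) f‖ ^ 2 - 1 / (2 * σ + 2) * ‖f 0‖ ^ (2 * σ + 2)

/-- Test functions: smooth compactly supported complex functions of `(t, x) ∈ ℝ × ℝⁿ`. -/
def IsTest {n : ℕ} (ψ : ℝ → Rn n → ℂ) : Prop :=
  ContDiff ℝ (⊤ : ℕ∞) (Function.uncurry ψ) ∧ HasCompactSupport (Function.uncurry ψ)

/-- The weak form, between the times `0` and `t`, of
`i u_t = ((-Δ)^s - |u|^{2σ} δ₀) u`, `u(0) = g`, tested against `ψ`. -/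
def WeakIdentity {n : ℕ} (s σ : ℝ) (g : Rn n → ℂ) (u ψ : ℝ → Rn n → ℂ) (t : ℝ) : Prop :=
  Complex.I * (pair (u t) (ψ t) - pair g (ψ 0)
      - ∫ τ in (0 : ℝ)..t, pair (u τ) (fun x => deriv (fun r => ψ r x) τ))
    = (∫ τ in (0 : ℝ)..t, pair (fracLap (s / 2) (u τ)) (fracLap (s / 2) (ψ τ)))
      - ∫ τ in (0 : ℝ)..t, ((‖u τ 0‖ ^ (2 * σ) : ℝ) : ℂ) * u τ 0 * conj (ψ τ 0)

/-- `u` is a weak solution, of class `C(I; H^s)`, on the time interval `I ∋ 0`, of the concentrated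
NLS with initial datum `g`. -/
structure IsSolutionOn {n : ℕ} (s σ : ℝ) (I : Set ℝ) (g : Rn n → ℂ) (u : ℝ → Rn n → ℂ) :
    Prop where
  initial : u 0 = g
  memHs : ∀ t ∈ I, MemHs s (u t)
  continuous : ∀ t₀ ∈ I, Tendsto (fun t => hsNorm s (u t - u t₀)) (𝓝[I] t₀) (𝓝 0)
  weak : ∀ t ∈ I, ∀ ψ : ℝ → Rn n → ℂ, IsTest ψ → WeakIdentity s σ g u ψ t

/-- The symbol `1 / ((2π|ξ|)^{2s} + ω)`. -/
def greenHat {n : ℕ} (s ω : ℝ) (ξ : Rn n) : ℝ := 1 / ((2 * Real.pi * ‖ξ‖) ^ (2 * s) + ω)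

/-- The profile `φ_ω`, given by
`φ̂_ω(ξ) = (∫ 1/((2π|η|)^{2s}+ω) dη)^{-(1+1/(2σ))} · 1/((2π|ξ|)^{2s}+ω)`. -/
def profile (n : ℕ) (s σ ω : ℝ) : Rn n → ℂ :=
  𝓕⁻ (fun ξ : Rn n =>
    (((∫ η : Rn n, greenHat s ω η) ^ (-(1 + 1 / (2 * σ))) * greenHat s ω ξ : ℝ) : ℂ))

/-- The rotated profile `e^{iα} φ_ω`. -/
def rotProfile (n : ℕ) (s σ ω α : ℝ) : Rn n → ℂ :=
  fun x => Complex.exp (Complex.I * (α : ℂ)) * profile n s σ ω x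

/-- First key assumption on a solution map `g ↦ u_g = U g`: continuous dependence on the initial
data at `φ_ω`, on some fixed time interval. -/
def ContinuousDependence {n : ℕ} (s σ ω : ℝ) (U : (Rn n → ℂ) → ℝ → Rn n → ℂ) : Prop :=
  ∃ T₀ > (0 : ℝ), ∀ ε > (0 : ℝ), ∃ δ > (0 : ℝ), ∀ g : Rn n → ℂ, MemHs s g →
    hsNorm s (g - profile n s σ ω) < δ →
      IsSolutionOn s σ (Ico 0 T₀) g (U g) ∧
      (⨆ t ∈ Ioo 0 T₀, ENNReal.ofReal (hsNorm s (U g t - rotProfile n s σ ω (ω * t))))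
        < ENNReal.ofReal ε

/-- Second key assumption on a solution map: all data in `H^s` close enough to `φ_ω` generate
global solutions, which conserve mass and energy. -/
def GlobalAndConservative {n : ℕ} (s σ ω : ℝ) (U : (Rn n → ℂ) → ℝ → Rn n → ℂ) : Prop :=
  ∃ r > (0 : ℝ), ∀ g : Rn n → ℂ, MemHs s g → hsNorm s (g - profile n s σ ω) < r →
    IsSolutionOn s σ (Ici 0) g (U g) ∧
    ∀ t ≥ (0 : ℝ), mass (U g t) = mass g ∧ energy s σ (U g t) = energy s σ g

/-- Orbital stability in `H^s` of `e^{iωt} φ_ω`, for the solution map `U`. -/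
def OrbitallyStable {n : ℕ} (s σ ω : ℝ) (U : (Rn n → ℂ) → ℝ → Rn n → ℂ) : Prop :=
  ∀ ε > (0 : ℝ), ∃ δ > (0 : ℝ), ∀ g : Rn n → ℂ, MemHs s g → hsNorm s (g - profile n s σ ω) < δ →
    IsSolutionOn s σ (Ici 0) g (U g) ∧
    (⨆ t ∈ Ioi (0 : ℝ), ⨅ θ : ℝ,
      ENNReal.ofReal (hsNorm s (U g t - rotProfile n s σ ω (ω * t + θ)))) < ENNReal.ofReal ε

end

end ConcNLS

/-! ### Fourier inversion and Plancherel on `H^s` -/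

namespace ConcNLS

/-! Write `ρ_l` for the value at `0` of the profile `φ_l` of frequency `l`; it is a constant times a
positive power of `l`. Multiples of `φ_l` are the extremals of the trace inequality `‖f 0‖² ρ_l^{2σ}
≤ ‖(-Δ)^{s/2} f‖² + l M(f)`, and the deficit is the same quadratic form at `f - z φ_l`, where `z = f
0 / ρ_l` (`quadForm_sub_smul_profile`).

Given `f`, choose `l` with `‖f 0‖ = ρ_l`. The trace inequality then gives `2 E(f) + l M(f) ≥ d(l) =
C l^p` (`action_lower_bound`), where `d(ω)` is the action of `φ_ω` and `d'(ω) = M(φ_ω)`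
(`action_profile`, `mass_profile`). If `E(f)` and `M(f)` are close to their values at `φ_ω`, then
`d(l)` barely exceeds its tangent at `ω`. Since `p > 1`, which is the condition `σ < 2s/n - 1`,
strict convexity forces `l` near `ω`, hence `‖f 0‖` near `ρ_ω`.

The deficit at frequency `ω` depends only on `E(f)`, `M(f)` and `‖f 0‖`, so it is small: `f` is
close to `z φ_ω` with `‖z‖` close to `1`. Conservation of `E` and `M` makes this hold at all times.
-/

/-- The inverse Fourier transform is self-adjoint for the bilinear pairing. -/
theorem integral_fourierInv_mul_eq {V : Type*} [NormedAddCommGroup V] [InnerProductSpace ℝ V]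
    [MeasurableSpace V] [BorelSpace V] [FiniteDimensional ℝ V] {f g : V → ℂ}
    (hf : Integrable f) (hg : Integrable g) :
    ∫ x, 𝓕⁻ f x * g x = ∫ x, f x * 𝓕⁻ g x := by
  have h := VectorFourier.integral_fourierIntegral_smul_eq_flip (μ := (volume : Measure V))
    (ν := (volume : Measure V)) (L := -innerₗ V) (e := Real.fourierChar) (f := f) (g := g)
    Real.continuous_fourierChar (by simpa using! continuous_inner.neg) hf hg
  have h2 : ∀ f : V → ℂ, VectorFourier.fourierIntegral Real.fourierChar volume (-innerₗ V) f
      = 𝓕⁻ f := by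
    intro f; ext w
    rw [Real.fourierInv_eq]
    simp [VectorFourier.fourierIntegral]
  have h3 : (-innerₗ V).flip = -innerₗ V := by
    ext x y; simp [real_inner_comm]
  rw [h3, h2, h2] at h
  simpa using h

theorem continuous_fourierInv {V : Type*} [NormedAddCommGroup V] [InnerProductSpace ℝ V]
    [MeasurableSpace V] [BorelSpace V] [FiniteDimensional ℝ V] {f : V → ℂ}
    (hf : Integrable f) : Continuous (𝓕⁻ f) := by
  have h : 𝓕⁻ f = fun x => 𝓕 f (-x) := by
    ext x; rw [Real.fourierInv_eq_fourier_neg]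
  rw [h]
  have := VectorFourier.fourierIntegral_continuous (μ := (volume : Measure V))
    Real.continuous_fourierChar (L := innerₗ V) (by simpa using! continuous_inner) hf
  exact this.comp continuous_neg

/-- On `L¹ ∩ L²` the inverse Fourier transform of `L²` is given by the integral. -/
theorem lp_fourierInv_ae_eq {V : Type*} [NormedAddCommGroup V] [InnerProductSpace ℝ V]
    [MeasurableSpace V] [BorelSpace V] [FiniteDimensional ℝ V]
    (F : Lp ℂ 2 (volume : Measure V)) (hF : Integrable F) :
    ⇑(𝓕⁻ F : Lp ℂ 2 (volume : Measure V)) =ᵐ[volume] 𝓕⁻ (⇑F) := by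
  apply ae_eq_of_integral_contDiff_smul_eq
  · exact (Lp.memLp _).locallyIntegrable (by norm_num)
  · exact (continuous_fourierInv hF).locallyIntegrable
  intro g hg hc
  have hg₁ : HasCompactSupport (Complex.ofRealCLM ∘ g) := hc.comp_left rfl
  have hg₂ : ContDiff ℝ (⊤ : ℕ∞) (Complex.ofRealCLM ∘ g) := by fun_prop
  set G := hg₁.toSchwartzMap hg₂ with hG
  have hGx : ∀ x, G x = (g x : ℂ) := fun x => rfl
  -- The `L²` inverse transform agrees with the distributional one, which moves `𝓕⁻` onto the test
  -- function `G`.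
  have key := congrArg (fun T => T G) (Lp.fourierInv_toTemperedDistribution_eq F)
  simp only [TemperedDistribution.fourierInv_apply, Lp.toTemperedDistribution_apply] at key
  calc ∫ x, g x • (𝓕⁻ F : Lp ℂ 2 (volume : Measure V)) x
      = ∫ x, G x • (𝓕⁻ F : Lp ℂ 2 (volume : Measure V)) x := by
        simp [hGx]
    _ = ∫ x, (𝓕⁻ G) x • F x := key.symm
    _ = ∫ x, 𝓕⁻ (⇑G) x * F x := by simp [SchwartzMap.fourierInv_coe]
    _ = ∫ x, G x * 𝓕⁻ (⇑F) x := integral_fourierInv_mul_eq G.integrable hF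
    _ = ∫ x, g x • 𝓕⁻ (⇑F) x := by simp [hGx]

variable {n : ℕ}

theorem memLp_l2Fourier (f : Rn n → ℂ) : MemLp (l2Fourier f) 2 volume := by
  unfold l2Fourier
  split_ifs
  · exact Lp.memLp _
  · exact MemLp.zero

theorem l2Fourier_of_memLp {f : Rn n → ℂ} (hf : MemLp f 2 volume) :
    l2Fourier f = ⇑(𝓕 (hf.toLp f) : Lp ℂ 2 (volume : Measure (Rn n))) := by
  simp [l2Fourier, hf]

/-- Combinations `f - z • g` are the only ones needed: differences (`z = 1`) and removal of a
multiple of the profile. -/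
theorem l2Fourier_sub_smul {f g : Rn n → ℂ} (hf : MemLp f 2 volume) (hg : MemLp g 2 volume)
    (z : ℂ) : l2Fourier (f - z • g) =ᵐ[volume] l2Fourier f - z • l2Fourier g := by
  rw [l2Fourier_of_memLp hf, l2Fourier_of_memLp hg, l2Fourier_of_memLp (hf.sub (hg.const_smul z))]
  rw [MemLp.toLp_sub hf (hg.const_smul z), MemLp.toLp_const_smul z hg]
  rw [sub_eq_add_neg, ← neg_one_smul ℂ, FourierTransform.fourier_add,
    FourierTransform.fourier_smul, FourierTransform.fourier_smul, neg_one_smul, ← sub_eq_add_neg]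
  filter_upwards [Lp.coeFn_sub (𝓕 (hf.toLp f)) (z • 𝓕 (hg.toLp g)),
    Lp.coeFn_smul z (𝓕 (hg.toLp g))] with x h1 h2
  rw [h1, Pi.sub_apply, h2, Pi.sub_apply]

theorem fracLapHat_sub_smul {f g : Rn n → ℂ} (hf : MemLp f 2 volume) (hg : MemLp g 2 volume)
    (a : ℝ) (z : ℂ) :
    fracLapHat a (f - z • g) =ᵐ[volume] fracLapHat a f - z • fracLapHat a g := by
  filter_upwards [l2Fourier_sub_smul hf hg z] with x hx
  simp only [fracLapHat, hx, Pi.sub_apply, Pi.smul_apply, smul_eq_mul]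
  ring

variable {s : ℝ}

theorem MemHs.sub_smul {f g : Rn n → ℂ} (hf : MemHs s f) (hg : MemHs s g) (z : ℂ) :
    MemHs s (f - z • g) :=
  ⟨hf.1.sub (hg.1.const_smul z), hf.2.1.sub (hg.2.1.const_smul z),
    (hf.2.2.sub (hg.2.2.const_smul z)).ae_eq (fracLapHat_sub_smul hf.2.1 hg.2.1 _ z).symm⟩

theorem fracLap_of_memHs {f : Rn n → ℂ} (hf : MemHs s f) :
    fracLap (s / 2) f = 𝓕⁻ (hf.2.2.toLp (fracLapHat (s / 2) f)) := by
  simp [fracLap, hf.2.2]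

theorem fracLap_sub_smul {f g : Rn n → ℂ} (hf : MemHs s f) (hg : MemHs s g) (z : ℂ) :
    fracLap (s / 2) (f - z • g) = fracLap (s / 2) f - z • fracLap (s / 2) g := by
  rw [fracLap_of_memHs hf, fracLap_of_memHs hg, fracLap_of_memHs (hf.sub_smul hg z)]
  have : (hf.sub_smul hg z).2.2.toLp (fracLapHat (s / 2) (f - z • g))
      = hf.2.2.toLp (fracLapHat (s / 2) f)
        + (-1 : ℂ) • z • hg.2.2.toLp (fracLapHat (s / 2) g) := by
    rw [neg_one_smul, ← sub_eq_add_neg, ← MemLp.toLp_const_smul, ← MemLp.toLp_sub]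
    exact MemLp.toLp_congr _ _ (fracLapHat_sub_smul hf.2.1 hg.2.1 _ z)
  rw [this, FourierTransform.fourierInv_add, FourierTransform.fourierInv_smul,
    FourierTransform.fourierInv_smul,
    neg_one_smul, ← sub_eq_add_neg]

theorem norm_sq_toLp {f : Rn n → ℂ} (hf : MemLp f 2 volume) :
    ‖hf.toLp f‖ ^ 2 = ∫ x, ‖f x‖ ^ 2 := by
  have h := L2.inner_def (𝕜 := ℂ) (hf.toLp f) (hf.toLp f)
  rw [inner_self_eq_norm_sq_to_K] at h
  have h2 : ∫ x, inner ℂ ((hf.toLp f) x) ((hf.toLp f) x) = ((∫ x, ‖f x‖ ^ 2 : ℝ) : ℂ) := by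
    rw [← integral_complex_ofReal]
    apply integral_congr_ae
    filter_upwards [hf.coeFn_toLp] with x hx
    rw [hx, inner_self_eq_norm_sq_to_K]; norm_cast
  rw [h2] at h
  exact Complex.ofReal_injective (by simpa using h)

theorem mass_eq_sq {f : Rn n → ℂ} (hf : MemLp f 2 volume) :
    mass f = (eLpNorm f 2 volume).toReal ^ 2 := by
  rw [mass, ← norm_sq_toLp hf, Lp.norm_toLp]

/-- Plancherel's identity for the mass. -/
theorem mass_eq_integral {f : Rn n → ℂ} (hf : MemLp f 2 volume) :
    mass f = ∫ ξ, ‖l2Fourier f ξ‖ ^ 2 := by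
  rw [mass, ← norm_sq_toLp hf, ← Lp.norm_fourier_eq, ← norm_sq_toLp (memLp_l2Fourier f)]
  congr 2
  apply Lp.ext
  filter_upwards [(memLp_l2Fourier f).coeFn_toLp] with x hx
  rw [hx, l2Fourier_of_memLp hf]

theorem norm_fracLapHat_sq (f : Rn n → ℂ) (ξ : Rn n) :
    ‖fracLapHat (s / 2) f ξ‖ ^ 2 = (2 * Real.pi * ‖ξ‖) ^ (2 * s) * ‖l2Fourier f ξ‖ ^ 2 := by
  have h0 : 0 ≤ 2 * Real.pi * ‖ξ‖ := by positivity
  rw [fracLapHat, norm_mul, mul_pow, Complex.norm_real, Real.norm_of_nonneg (by positivity),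
    ← Real.rpow_natCast, ← Real.rpow_mul h0]
  congr 2
  push_cast; ring

theorem norm_fracLap_sq {f : Rn n → ℂ} (hf : MemHs s f) :
    ‖fracLap (s / 2) f‖ ^ 2 = ∫ ξ, (2 * Real.pi * ‖ξ‖) ^ (2 * s) * ‖l2Fourier f ξ‖ ^ 2 := by
  have h : ‖fracLap (s / 2) f‖ = ‖hf.2.2.toLp (fracLapHat (s / 2) f)‖ := by
    rw [fracLap_of_memHs hf]
    exact (Lp.fourierTransformₗᵢ (Rn n) ℂ).symm.norm_map _
  rw [h, norm_sq_toLp]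
  simp_rw [norm_fracLapHat_sq]

theorem integrable_symbol_mul_sq {f : Rn n → ℂ} (hf : MemHs s f) :
    Integrable fun ξ => (2 * Real.pi * ‖ξ‖) ^ (2 * s) * ‖l2Fourier f ξ‖ ^ 2 := by
  have := (memLp_two_iff_integrable_sq_norm hf.2.2.1).1 hf.2.2
  simpa only [norm_fracLapHat_sq] using this

theorem integrable_l2Fourier_sq (f : Rn n → ℂ) : Integrable fun ξ => ‖l2Fourier f ξ‖ ^ 2 :=
  (memLp_two_iff_integrable_sq_norm (memLp_l2Fourier f).1).1 (memLp_l2Fourier f)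

end ConcNLS

/-! ### The Green symbol, its scaling, and the profile -/

namespace ConcNLS

variable {n : ℕ} {s σ l : ℝ}

theorem greenHat_pos (hl : 0 < l) (ξ : Rn n) : 0 < greenHat s l ξ := by
  unfold greenHat; positivity

theorem symbol_add_mul_greenHat (hl : 0 < l) (ξ : Rn n) :
    ((2 * Real.pi * ‖ξ‖) ^ (2 * s) + l) * greenHat s l ξ = 1 := by
  have : 0 < (2 * Real.pi * ‖ξ‖) ^ (2 * s) + l := by positivity
  unfold greenHat; field_simp

theorem measurable_greenHat (s l : ℝ) : Measurable (greenHat s l : Rn n → ℝ) := by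
  unfold greenHat; fun_prop

/-- Comparison with `(1 + ‖ξ‖)^{-2s}`, integrable since `2s > n`. With `w` the symbol, the constant
comes from `(1 + ‖ξ‖)^{2s} ≤ 2^{2s} (1 + w)` and `1 + w ≤ (1 + l⁻¹)(w + l)`. -/
theorem integrable_greenHat (hs : (n : ℝ) / 2 < s) (hl : 0 < l) :
    Integrable (greenHat s l : Rn n → ℝ) := by
  have hs0 : 0 < s := lt_of_le_of_lt (by positivity) hs
  have h := integrable_one_add_norm (E := Rn n) (μ := volume) (r := 2 * s)
    (by rw [finrank_euclideanSpace_fin]; linarith)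
  apply (h.const_mul (2 ^ (2 * s) * (1 + l⁻¹))).mono' (measurable_greenHat s l).aestronglyMeasurable
  refine Eventually.of_forall fun ξ => ?_
  rw [Real.norm_of_nonneg (greenHat_pos hl ξ).le, Real.rpow_neg (by positivity), greenHat, one_div]
  set w := (2 * Real.pi * ‖ξ‖) ^ (2 * s) with hw
  have hw0 : 0 ≤ w := by positivity
  have h1 : (1 + ‖ξ‖) ^ (2 * s) ≤ 2 ^ (2 * s) * (1 + w) := by
    have hm : (1 + ‖ξ‖) ^ (2 * s) ≤ (2 * max 1 ‖ξ‖) ^ (2 * s) := by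
      apply Real.rpow_le_rpow (by positivity) _ (by positivity)
      linarith [le_max_left 1 ‖ξ‖, le_max_right 1 ‖ξ‖]
    rw [Real.mul_rpow (by norm_num) (by positivity)] at hm
    refine hm.trans ?_
    gcongr
    rcases max_cases 1 ‖ξ‖ with ⟨h, _⟩ | ⟨h, _⟩
    · rw [h, Real.one_rpow]; linarith
    · rw [h]
      have : ‖ξ‖ ^ (2 * s) ≤ w := by
        apply Real.rpow_le_rpow (by positivity) _ (by positivity)
        have := Real.pi_gt_three
        nlinarith [norm_nonneg ξ]
      linarith
  have hp : 0 < (1 + ‖ξ‖) ^ (2 * s) := by positivity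
  rw [inv_le_iff_one_le_mul₀ (by positivity), ← div_eq_mul_inv, div_mul_eq_mul_div,
    le_div_iff₀ hp, one_mul]
  refine h1.trans ?_
  rw [mul_assoc]
  gcongr
  have : l⁻¹ * l = 1 := inv_mul_cancel₀ hl.ne'
  nlinarith [mul_nonneg (inv_nonneg.2 hl.le) hw0]

theorem integral_greenHat_pos (hs : (n : ℝ) / 2 < s) (hl : 0 < l) :
    0 < ∫ ξ : Rn n, greenHat s l ξ := by
  rw [integral_pos_iff_support_of_nonneg (fun ξ => (greenHat_pos hl ξ).le)
    (integrable_greenHat hs hl)]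
  have : Function.support (greenHat s l : Rn n → ℝ) = univ := by
    ext ξ; simpa using (greenHat_pos hl ξ).ne'
  rw [this]
  exact isOpen_univ.measure_pos volume univ_nonempty

/-- Scaling of the integral of the Green symbol in the frequency parameter. -/
theorem integral_greenHat_eq (hs : (n : ℝ) / 2 < s) (hl : 0 < l) :
    ∫ ξ : Rn n, greenHat s l ξ
      = l ^ (-(1 - n / (2 * s))) * ∫ ξ : Rn n, greenHat s 1 ξ := by
  have hs0 : 0 < s := lt_of_le_of_lt (by positivity) hs
  -- Dilation by this `R` multiplies the symbol by `l`.
  set R := l ^ (1 / (2 * s)) with hR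
  have hR0 : 0 < R := by positivity
  have h := Measure.integral_comp_smul_of_nonneg (volume : Measure (Rn n)) (greenHat s l) R
    (hR := hR0.le)
  have h1 : ∀ ξ : Rn n, greenHat s l (R • ξ) = l⁻¹ * greenHat s 1 ξ := by
    intro ξ
    have : (2 * Real.pi * ‖R • ξ‖) ^ (2 * s) = l * (2 * Real.pi * ‖ξ‖) ^ (2 * s) := by
      rw [norm_smul, Real.norm_of_nonneg hR0.le,
        show 2 * Real.pi * (R * ‖ξ‖) = R * (2 * Real.pi * ‖ξ‖) by ring,
        Real.mul_rpow hR0.le (by positivity), hR, ← Real.rpow_mul hl.le]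
      congr 1
      rw [one_div_mul_cancel (by positivity), Real.rpow_one]
    rw [greenHat, greenHat, this]
    have : 0 < (2 * Real.pi * ‖ξ‖) ^ (2 * s) + 1 := by positivity
    field_simp
  simp_rw [h1] at h
  rw [integral_const_mul, finrank_euclideanSpace_fin, smul_eq_mul] at h
  have h2 : R ^ n = l ^ ((n : ℝ) / (2 * s)) := by
    rw [hR, ← Real.rpow_natCast, ← Real.rpow_mul hl.le]
    congr 1; ring
  have h3 : l ^ (-(1 - n / (2 * s))) = R ^ n * l⁻¹ := by
    rw [h2, ← Real.rpow_neg_one l, ← Real.rpow_add hl]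
    congr 1; ring
  rw [h3, mul_assoc, h, ← mul_assoc, mul_inv_cancel₀ (by positivity), one_mul]

/-- Pointwise Young inequality: with `(w + 1) g = 1`, expanding `0 ≤ (w + 1)(a - g)²` gives `2a ≤ g
+ (w + 1) a²`, whose right side is integrable. -/
theorem integrable_l2Fourier (hs : (n : ℝ) / 2 < s) {f : Rn n → ℂ} (hf : MemHs s f) :
    Integrable (l2Fourier f) := by
  have h := (integrable_greenHat (n := n) hs one_pos).add
    ((integrable_symbol_mul_sq hf).add (integrable_l2Fourier_sq f))
  apply h.mono' (memLp_l2Fourier f).1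
  refine Eventually.of_forall fun ξ => ?_
  have h1 := symbol_add_mul_greenHat (s := s) one_pos ξ
  have h2 := greenHat_pos (s := s) one_pos ξ
  set w := (2 * Real.pi * ‖ξ‖) ^ (2 * s)
  set g := greenHat s 1 ξ
  have hw : 0 < w + 1 := by positivity
  simp only [Pi.add_apply]
  set a := ‖l2Fourier f ξ‖
  have ha : 0 ≤ a := norm_nonneg _
  have h3 : 0 ≤ (w + 1) * (a - g) ^ 2 := by positivity
  have h4 : (w + 1) * (a - g) ^ 2 = (w + 1) * a ^ 2 - 2 * a * ((w + 1) * g) + ((w + 1) * g) * g := by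
    ring
  rw [h4, h1] at h3
  nlinarith

/-- Functions in `H^s`, `s > n / 2`, are given by Fourier inversion. -/
theorem MemHs.eq_fourierInv (hs : (n : ℝ) / 2 < s) {f : Rn n → ℂ} (hf : MemHs s f) :
    f = 𝓕⁻ (l2Fourier f) := by
  have hi := integrable_l2Fourier hs hf
  have h1 := l2Fourier_of_memLp hf.2.1
  rw [← Continuous.ae_eq_iff_eq volume hf.1 (continuous_fourierInv hi)]
  rw [h1] at hi ⊢
  have := lp_fourierInv_ae_eq _ hi
  rw [FourierTransform.fourierInv_fourier_eq] at this
  exact hf.2.1.coeFn_toLp.symm.trans this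

theorem MemHs.apply_zero (hs : (n : ℝ) / 2 < s) {f : Rn n → ℂ} (hf : MemHs s f) :
    f 0 = ∫ ξ, l2Fourier f ξ := by
  conv_lhs => rw [hf.eq_fourierInv hs]
  rw [Real.fourierInv_eq]
  simp

theorem profileHat_integrable (hs : (n : ℝ) / 2 < s) (hl : 0 < l) (k : ℝ) :
    Integrable fun ξ : Rn n => ((k * greenHat s l ξ : ℝ) : ℂ) :=
  ((integrable_greenHat hs hl).const_mul k).ofReal

theorem greenHat_le (hl : 0 < l) (ξ : Rn n) : greenHat s l ξ ≤ l⁻¹ := by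
  unfold greenHat
  rw [one_div]
  gcongr
  linarith [show 0 ≤ (2 * Real.pi * ‖ξ‖) ^ (2 * s) by positivity]

theorem profileHat_memLp (hs : (n : ℝ) / 2 < s) (hl : 0 < l) (k : ℝ) :
    MemLp (fun ξ : Rn n => ((k * greenHat s l ξ : ℝ) : ℂ)) 2 volume := by
  rw [memLp_two_iff_integrable_sq_norm (profileHat_integrable hs hl k).1]
  apply ((integrable_greenHat (n := n) hs hl).const_mul (k ^ 2 * l⁻¹)).mono'
    ((profileHat_integrable hs hl k).1.norm.pow 2)
  refine Eventually.of_forall fun ξ => ?_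
  have h1 := greenHat_le (s := s) hl ξ
  have h2 := greenHat_pos (s := s) hl ξ
  rw [Pi.pow_apply, norm_pow, norm_norm, Complex.norm_real, Real.norm_eq_abs, sq_abs]
  calc (k * greenHat s l ξ) ^ 2 = k ^ 2 * (greenHat s l ξ * greenHat s l ξ) := by ring
    _ ≤ k ^ 2 * (l⁻¹ * greenHat s l ξ) := by gcongr
    _ = _ := by ring

theorem fourierInv_eq_toLp {F : Rn n → ℂ} (h1 : Integrable F) (h2 : MemLp F 2 volume) :
    ⇑(𝓕⁻ (h2.toLp F) : Lp ℂ 2 (volume : Measure (Rn n))) =ᵐ[volume] 𝓕⁻ F := by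
  have h := lp_fourierInv_ae_eq (h2.toLp F) (h1.congr h2.coeFn_toLp.symm)
  have h3 : 𝓕⁻ (⇑(h2.toLp F)) = 𝓕⁻ F := by
    ext x
    rw [Real.fourierInv_eq, Real.fourierInv_eq]
    apply integral_congr_ae
    filter_upwards [h2.coeFn_toLp] with y hy
    rw [hy]
  rwa [h3] at h

theorem memLp_fourierInv {F : Rn n → ℂ} (h1 : Integrable F) (h2 : MemLp F 2 volume) :
    MemLp (𝓕⁻ F) 2 volume :=
  (Lp.memLp _).ae_eq (fourierInv_eq_toLp h1 h2)

theorem l2Fourier_fourierInv {F : Rn n → ℂ} (h1 : Integrable F) (h2 : MemLp F 2 volume) :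
    l2Fourier (𝓕⁻ F) =ᵐ[volume] F := by
  rw [l2Fourier_of_memLp (memLp_fourierInv h1 h2)]
  have : (memLp_fourierInv h1 h2).toLp (𝓕⁻ F) = 𝓕⁻ (h2.toLp F) := by
    apply Lp.ext
    exact (MemLp.coeFn_toLp _).trans (fourierInv_eq_toLp h1 h2).symm
  rw [this, FourierTransform.fourier_fourierInv_eq]
  exact h2.coeFn_toLp

theorem l2Fourier_profile (hs : (n : ℝ) / 2 < s) (hl : 0 < l) :
    l2Fourier (profile n s σ l) =ᵐ[volume] fun ξ =>
      (((∫ η : Rn n, greenHat s l η) ^ (-(1 + 1 / (2 * σ))) * greenHat s l ξ : ℝ) : ℂ) :=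
  l2Fourier_fourierInv (profileHat_integrable hs hl _) (profileHat_memLp hs hl _)

theorem memHs_profile (hs : (n : ℝ) / 2 < s) (hl : 0 < l) : MemHs s (profile n s σ l) := by
  have hi := profileHat_integrable (n := n) hs hl ((∫ η : Rn n, greenHat s l η) ^ (-(1 + 1 / (2 * σ))))
  refine ⟨continuous_fourierInv hi, memLp_fourierInv hi (profileHat_memLp hs hl _), ?_⟩
  have hm : AEStronglyMeasurable (fracLapHat (s / 2) (profile n s σ l)) volume := by
    refine AEStronglyMeasurable.mul ?_ (memLp_l2Fourier _).1
    apply Measurable.aestronglyMeasurable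
    fun_prop
  rw [memLp_two_iff_integrable_sq_norm hm]
  apply ((integrable_greenHat (n := n) hs hl).const_mul
    (((∫ η : Rn n, greenHat s l η) ^ (-(1 + 1 / (2 * σ)))) ^ 2)).mono' (hm.norm.pow 2)
  filter_upwards [l2Fourier_profile (σ := σ) hs hl] with ξ hξ
  have h1 := symbol_add_mul_greenHat (s := s) hl ξ
  have h2 := greenHat_pos (s := s) hl ξ
  rw [Pi.pow_apply, norm_pow, norm_norm, norm_fracLapHat_sq, hξ, Complex.norm_real,
    Real.norm_eq_abs, sq_abs]
  set w := (2 * Real.pi * ‖ξ‖) ^ (2 * s)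
  set k := (∫ η : Rn n, greenHat s l η) ^ (-(1 + 1 / (2 * σ)))
  set g := greenHat s l ξ
  clear_value w k g
  have h3 : w * g ≤ 1 := by
    rw [← h1]
    exact mul_le_mul_of_nonneg_right (le_add_of_nonneg_right hl.le) h2.le
  calc w * (k * g) ^ 2 = k ^ 2 * ((w * g) * g) := by ring
    _ ≤ k ^ 2 * (1 * g) := by gcongr
    _ = _ := by ring

/-- The value of the profile at the origin. -/
noncomputable def peak (n : ℕ) (s σ l : ℝ) : ℝ :=
  (∫ η : Rn n, greenHat s l η) ^ (-(1 / (2 * σ)))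

theorem peak_pos (hs : (n : ℝ) / 2 < s) (hl : 0 < l) : 0 < peak n s σ l :=
  Real.rpow_pos_of_pos (integral_greenHat_pos hs hl) _

/-- The reciprocal of the Green integral is the sharp trace constant; the exponent in the profile's
coefficient is tuned so that it equals `φ_l(0)^{2σ}`. -/
theorem peak_rpow (hs : (n : ℝ) / 2 < s) (hσ : 0 < σ) (hl : 0 < l) :
    peak n s σ l ^ (2 * σ) = (∫ η : Rn n, greenHat s l η)⁻¹ := by
  rw [peak, ← Real.rpow_mul (integral_greenHat_pos hs hl).le, ← Real.rpow_neg_one]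
  congr 1; field_simp

/-- As the exponent of `l` is positive, every positive number is the peak of exactly one frequency,
which allows `l` to be read off from `‖f 0‖`. -/
theorem peak_eq (hs : (n : ℝ) / 2 < s) (hl : 0 < l) :
    peak n s σ l = peak n s σ 1 * l ^ ((1 - n / (2 * s)) / (2 * σ)) := by
  have h1 := integral_greenHat_pos (n := n) hs one_pos
  rw [peak, integral_greenHat_eq hs hl, Real.mul_rpow (by positivity) h1.le, ← Real.rpow_mul hl.le,
    peak, mul_comm]
  congr 2; ring

theorem profile_coeff_mul (hs : (n : ℝ) / 2 < s) (hl : 0 < l) :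
    (∫ η : Rn n, greenHat s l η) ^ (-(1 + 1 / (2 * σ))) * ∫ η : Rn n, greenHat s l η
      = peak n s σ l := by
  have h := integral_greenHat_pos (n := n) hs hl
  conv_lhs => rw [← Real.rpow_one (∫ η : Rn n, greenHat s l η), ← Real.rpow_mul h.le, ← Real.rpow_add h]
  rw [peak]
  congr 1; ring

theorem profile_zero (hs : (n : ℝ) / 2 < s) (hl : 0 < l) :
    profile n s σ l 0 = peak n s σ l := by
  rw [(memHs_profile hs hl).apply_zero hs, integral_congr_ae (l2Fourier_profile hs hl),
    integral_complex_ofReal, integral_const_mul, profile_coeff_mul hs hl]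

/-! ### The quadratic form and its extremal decomposition -/

/-- The quadratic form `‖(-Δ)^{s/2} f‖² + l ‖f‖²`. -/
noncomputable def quadForm (s l : ℝ) (f : Rn n → ℂ) : ℝ :=
  ‖fracLap (s / 2) f‖ ^ 2 + l * mass f

theorem mass_nonneg (f : Rn n → ℂ) : 0 ≤ mass f :=
  integral_nonneg fun _ => by positivity

theorem quadForm_nonneg (hl : 0 < l) (f : Rn n → ℂ) : 0 ≤ quadForm s l f := by
  have := mass_nonneg f
  unfold quadForm; positivity

theorem quadForm_eq_integral {f : Rn n → ℂ} (hf : MemHs s f) :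
    quadForm s l f = ∫ ξ, ((2 * Real.pi * ‖ξ‖) ^ (2 * s) + l) * ‖l2Fourier f ξ‖ ^ 2 := by
  rw [quadForm, norm_fracLap_sq hf, mass_eq_integral hf.2.1, ← integral_const_mul,
    ← integral_add (integrable_symbol_mul_sq hf) ((integrable_l2Fourier_sq f).const_mul l)]
  simp_rw [add_mul]

theorem integrable_quadForm {f : Rn n → ℂ} (hf : MemHs s f) :
    Integrable fun ξ => ((2 * Real.pi * ‖ξ‖) ^ (2 * s) + l) * ‖l2Fourier f ξ‖ ^ 2 := by
  simp_rw [add_mul]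
  exact (integrable_symbol_mul_sq hf).add ((integrable_l2Fourier_sq f).const_mul l)

/-- Orthogonal decomposition along the profile for the quadratic form. -/
theorem quadForm_sub_smul_profile (hs : (n : ℝ) / 2 < s) (hσ : 0 < σ) (hl : 0 < l)
    {f : Rn n → ℂ} (hf : MemHs s f) :
    quadForm s l (f - (f 0 / (peak n s σ l : ℂ)) • profile n s σ l)
      = quadForm s l f - ‖f 0‖ ^ 2 * peak n s σ l ^ (2 * σ) := by
  have hφ := memHs_profile (n := n) (σ := σ) hs hl
  have hG := integral_greenHat_pos (n := n) hs hl
  have hk := profile_coeff_mul (n := n) (σ := σ) hs hl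
  have hi := integrable_l2Fourier hs hf
  have hp := peak_pos (n := n) (σ := σ) hs hl
  have hg := integrable_greenHat (n := n) hs hl
  set z : ℂ := f 0 / (peak n s σ l : ℂ) with hz
  set k := (∫ η : Rn n, greenHat s l η) ^ (-(1 + 1 / (2 * σ))) with hkdef
  rw [quadForm_eq_integral (hf.sub_smul hφ z), quadForm_eq_integral hf, peak_rpow hs hσ hl]
  -- Since `(w + l) * greenHat = 1`, the weight disappears from the cross term, which then
  -- integrates to a multiple of `f 0` by Fourier inversion.
  have h1 : (fun ξ : Rn n => ((2 * Real.pi * ‖ξ‖) ^ (2 * s) + l)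
        * ‖l2Fourier (f - z • profile n s σ l) ξ‖ ^ 2) =ᵐ[volume]
      fun ξ => ((2 * Real.pi * ‖ξ‖) ^ (2 * s) + l) * ‖l2Fourier f ξ‖ ^ 2
        - 2 * k * (conj z * l2Fourier f ξ).re + ‖z‖ ^ 2 * k ^ 2 * greenHat s l ξ := by
    filter_upwards [l2Fourier_sub_smul hf.2.1 hφ.2.1 z, l2Fourier_profile (σ := σ) hs hl]
      with ξ h1 h2
    have h3 := symbol_add_mul_greenHat (s := s) hl ξ
    rw [h1, Pi.sub_apply, Pi.smul_apply, h2, ← hkdef]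
    set w := (2 * Real.pi * ‖ξ‖) ^ (2 * s)
    set g := greenHat s l ξ
    simp only [← Complex.normSq_eq_norm_sq, Complex.normSq_apply, smul_eq_mul, Complex.sub_re,
      Complex.sub_im, Complex.mul_re, Complex.mul_im, Complex.ofReal_re, Complex.ofReal_im,
      Complex.conj_re, Complex.conj_im]
    linear_combination (-2 * k * (z.re * (l2Fourier f ξ).re + z.im * (l2Fourier f ξ).im)
      + k ^ 2 * g * (z.re * z.re + z.im * z.im)) * h3
  have hre : Integrable fun ξ => (conj z * l2Fourier f ξ).re := (hi.const_mul (conj z)).re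
  rw [integral_congr_ae h1, integral_add, integral_sub, integral_const_mul, integral_const_mul]
  · have h4 : ∫ ξ, (conj z * l2Fourier f ξ).re = (conj z * f 0).re := by
      rw [hf.apply_zero hs, ← integral_const_mul]
      exact integral_re (hi.const_mul (conj z))
    have h5 : f 0 = z * (peak n s σ l : ℂ) := by
      rw [hz, div_mul_cancel₀]; exact_mod_cast hp.ne'
    have h6 : (conj z * f 0).re = ‖z‖ ^ 2 * peak n s σ l := by
      rw [h5, ← mul_assoc, ← Complex.normSq_eq_conj_mul_self, ← Complex.ofReal_mul,
        Complex.ofReal_re, Complex.normSq_eq_norm_sq]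
    have h7 : ‖f 0‖ = ‖z‖ * peak n s σ l := by
      rw [h5, norm_mul, Complex.norm_real, Real.norm_of_nonneg hp.le]
    -- With `k ∫ greenHat = ρ`, the corrections `-2k‖z‖²ρ` and `‖z‖²k²∫ greenHat` add up to
    -- `-‖z‖²kρ`, which is `-‖f 0‖² / ∫ greenHat`.
    rw [h4, h6, h7, ← hk]
    field_simp
    ring
  · exact integrable_quadForm hf
  · exact hre.const_mul _
  · exact (integrable_quadForm hf).sub (hre.const_mul _)
  · exact hg.const_mul _

end ConcNLS

/-! ### Norm comparisons and the trace inequality -/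

namespace ConcNLS

variable {n : ℕ} {s σ ω l : ℝ}

theorem rotProfile_eq (α : ℝ) :
    rotProfile n s σ ω α = Complex.exp (Complex.I * (α : ℂ)) • profile n s σ ω := rfl

theorem hsNorm_nonneg (f : Rn n → ℂ) : 0 ≤ hsNorm s f := by
  unfold hsNorm; positivity

theorem hsNorm_sub_smul_le {f g : Rn n → ℂ} (hf : MemHs s f) (hg : MemHs s g) (z : ℂ) :
    hsNorm s (f - z • g) ≤ hsNorm s f + ‖z‖ * hsNorm s g := by
  unfold hsNorm
  rw [fracLap_sub_smul hf hg]
  have h1 : ‖fracLap (s / 2) f - z • fracLap (s / 2) g‖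
      ≤ ‖fracLap (s / 2) f‖ + ‖z‖ * ‖fracLap (s / 2) g‖ := by
    rw [← norm_smul]; exact norm_sub_le _ _
  have h2 : (eLpNorm (f - z • g) 2 volume).toReal
      ≤ (eLpNorm f 2 volume).toReal + ‖z‖ * (eLpNorm g 2 volume).toReal := by
    have h3 := norm_sub_le (hf.2.1.toLp f) (z • hg.2.1.toLp g)
    rwa [norm_smul, ← MemLp.toLp_const_smul, ← MemLp.toLp_sub, Lp.norm_toLp, Lp.norm_toLp,
      Lp.norm_toLp] at h3
  linarith

theorem abs_norm_fracLap_sub_le {f g : Rn n → ℂ} (hf : MemHs s f) (hg : MemHs s g) :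
    |‖fracLap (s / 2) f‖ - ‖fracLap (s / 2) g‖| ≤ hsNorm s (f - g) := by
  have h := fracLap_sub_smul hf hg 1
  rw [one_smul, one_smul] at h
  rw [hsNorm, h]
  exact (abs_norm_sub_norm_le _ _).trans (le_add_of_nonneg_right (by positivity))

theorem abs_eLpNorm_sub_le {f g : Rn n → ℂ} (hf : MemHs s f) (hg : MemHs s g) :
    |(eLpNorm f 2 volume).toReal - (eLpNorm g 2 volume).toReal| ≤ hsNorm s (f - g) := by
  have h := abs_norm_sub_norm_le (hf.2.1.toLp f) (hg.2.1.toLp g)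
  rw [← MemLp.toLp_sub, Lp.norm_toLp, Lp.norm_toLp, Lp.norm_toLp] at h
  exact h.trans (le_add_of_nonneg_left (by positivity))

theorem hsNorm_le_sqrt_quadForm (hl : 0 < l) {f : Rn n → ℂ} (hf : MemHs s f) :
    hsNorm s f ≤ √(quadForm s l f) * (1 + 1 / √l) := by
  have hm := mass_eq_sq hf.2.1
  have h0 := mass_nonneg f
  have h1 : ‖fracLap (s / 2) f‖ ≤ √(quadForm s l f) := by
    apply Real.le_sqrt_of_sq_le
    unfold quadForm
    nlinarith
  have h2 : (eLpNorm f 2 volume).toReal ≤ √(quadForm s l f) * (1 / √l) := by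
    rw [mul_one_div, ← Real.sqrt_div' _ hl.le]
    apply Real.le_sqrt_of_sq_le
    rw [← hm, le_div_iff₀ hl, quadForm]
    nlinarith [sq_nonneg ‖fracLap (s / 2) f‖]
  unfold hsNorm
  linarith

theorem quadForm_le_hsNorm_sq (hl : 0 < l) {f : Rn n → ℂ} (hf : MemHs s f) :
    quadForm s l f ≤ (1 + l) * hsNorm s f ^ 2 := by
  rw [quadForm, mass_eq_sq hf.2.1, hsNorm]
  have h1 : 0 ≤ ‖fracLap (s / 2) f‖ := norm_nonneg _
  have h2 : 0 ≤ (eLpNorm f 2 volume).toReal := ENNReal.toReal_nonneg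
  nlinarith [mul_nonneg h1 h2, mul_nonneg hl.le (mul_nonneg h1 h2), sq_nonneg ‖fracLap (s / 2) f‖,
    sq_nonneg (eLpNorm f 2 volume).toReal, mul_nonneg hl.le (sq_nonneg ‖fracLap (s / 2) f‖)]

/-- The sharp trace inequality at the origin. -/
theorem norm_apply_zero_sq_mul_le (hs : (n : ℝ) / 2 < s) (hσ : 0 < σ) (hl : 0 < l)
    {f : Rn n → ℂ} (hf : MemHs s f) :
    ‖f 0‖ ^ 2 * peak n s σ l ^ (2 * σ) ≤ quadForm s l f := by
  have h := quadForm_sub_smul_profile hs hσ hl hf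
  have := quadForm_nonneg (s := s) hl (f - (f 0 / (peak n s σ l : ℂ)) • profile n s σ l)
  linarith

theorem norm_apply_zero_le (hs : (n : ℝ) / 2 < s) :
    ∃ C : ℝ, 0 < C ∧ ∀ f : Rn n → ℂ, MemHs s f → ‖f 0‖ ≤ C * hsNorm s f := by
  -- The choice `σ = 1` is immaterial: `peak ^ (2 * σ)` does not depend on `σ`.
  have hp := peak_pos (n := n) (σ := 1) hs one_pos
  set B := peak n s 1 1 ^ (2 * (1 : ℝ)) with hB
  have hB0 : 0 < B := by positivity
  refine ⟨√(2 / B), by positivity, fun f hf => ?_⟩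
  have h1 := norm_apply_zero_sq_mul_le (σ := 1) hs one_pos one_pos hf
  have h2 := quadForm_le_hsNorm_sq one_pos hf
  rw [← hB] at h1
  rw [← Real.sqrt_sq (hsNorm_nonneg f), ← Real.sqrt_mul (by positivity)]
  apply Real.le_sqrt_of_sq_le
  rw [div_mul_eq_mul_div, le_div_iff₀ hB0]
  linarith

/-- Besides the conserved quantities, the quadratic form involves only `‖f 0‖`; this is why
controlling that one number suffices. -/
theorem quadForm_eq_energy (hσ : 0 < σ) (f : Rn n → ℂ) :
    quadForm s l f = 2 * energy s σ f + l * mass f + ‖f 0‖ ^ (2 * σ + 2) / (σ + 1) := by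
  unfold quadForm energy
  field_simp
  ring

theorem rpow_two_mul_add_two {r : ℝ} (hr : 0 ≤ r) (hσ : 0 < σ) :
    r ^ (2 * σ + 2) = r ^ 2 * r ^ (2 * σ) := by
  rw [Real.rpow_add_of_nonneg hr (by positivity) (by norm_num), mul_comm]
  norm_cast

/-- Equality case of the trace inequality: the remainder `φ - φ` vanishes. -/
theorem quadForm_profile (hs : (n : ℝ) / 2 < s) (hσ : 0 < σ) (hl : 0 < l) :
    quadForm s l (profile n s σ l) = peak n s σ l ^ (2 * σ + 2) := by
  have hφ := memHs_profile (n := n) (σ := σ) hs hl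
  have hp := peak_pos (n := n) (σ := σ) hs hl
  have h := quadForm_sub_smul_profile hs hσ hl hφ
  have h0 : quadForm s l (0 : Rn n → ℂ) = 0 := by
    have h1 := fracLap_sub_smul hφ hφ 1
    rw [one_smul, one_smul, sub_self, sub_self] at h1
    simp [quadForm, h1, mass]
  rw [profile_zero hs hl, div_self (by exact_mod_cast hp.ne'), one_smul, sub_self, h0,
    Complex.norm_real, Real.norm_of_nonneg hp.le] at h
  rw [rpow_two_mul_add_two hp.le hσ]
  linarith

/-! ### The minimal action and its derivative in the frequency -/

/-- Lower bound for the action in terms of the value at the origin. -/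
theorem action_lower_bound (hs : (n : ℝ) / 2 < s) (hσ : 0 < σ)
    (ha : 0 < (1 - n / (2 * s)) / (2 * σ)) (hl : 0 ≤ l) {f : Rn n → ℂ} (hf : MemHs s f)
    (hr : ‖f 0‖ = peak n s σ 1 * l ^ ((1 - n / (2 * s)) / (2 * σ))) :
    σ / (σ + 1) * ‖f 0‖ ^ (2 * σ + 2) ≤ 2 * energy s σ f + l * mass f := by
  rcases hl.eq_or_lt with rfl | hl
  -- Frequency `0` encodes `f 0 = 0`; there is no profile to compare with, but the action is then a
  -- square.
  · rw [Real.zero_rpow ha.ne', mul_zero] at hr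
    have h := quadForm_eq_energy (s := s) (l := 0) hσ f
    rw [hr, Real.zero_rpow (by positivity)] at h ⊢
    rw [zero_div, add_zero] at h
    have : 0 ≤ quadForm s 0 f := by unfold quadForm; rw [zero_mul]; positivity
    rw [mul_zero]
    linarith
  · rw [← peak_eq hs hl] at hr
    have h := quadForm_eq_energy (s := s) (l := l) hσ f
    have h1 := norm_apply_zero_sq_mul_le hs hσ hl hf
    rw [← hr, ← rpow_two_mul_add_two (norm_nonneg _) hσ] at h1
    have : σ / (σ + 1) * ‖f 0‖ ^ (2 * σ + 2)
      = ‖f 0‖ ^ (2 * σ + 2) - ‖f 0‖ ^ (2 * σ + 2) / (σ + 1) := by field_simp; ring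
    linarith

theorem norm_profile_zero (hs : (n : ℝ) / 2 < s) (hl : 0 < l) :
    ‖profile n s σ l 0‖ = peak n s σ l := by
  rw [profile_zero hs hl, Complex.norm_real, Real.norm_of_nonneg (peak_pos hs hl).le]

theorem action_profile (hs : (n : ℝ) / 2 < s) (hσ : 0 < σ) (hl : 0 < l) :
    2 * energy s σ (profile n s σ l) + l * mass (profile n s σ l)
      = σ / (σ + 1) * peak n s σ l ^ (2 * σ + 2) := by
  have h := quadForm_eq_energy (s := s) (l := l) hσ (profile n s σ l)
  rw [quadForm_profile hs hσ hl, norm_profile_zero hs hl] at h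
  have : σ / (σ + 1) * peak n s σ l ^ (2 * σ + 2)
      = peak n s σ l ^ (2 * σ + 2) - peak n s σ l ^ (2 * σ + 2) / (σ + 1) := by field_simp; ring
  linarith

/-- The Pohozaev-type identity for the mass of the profile. -/
theorem mass_profile (hs : (n : ℝ) / 2 < s) (hσ : 0 < σ) (hω : 0 < ω) :
    mass (profile n s σ ω) = (1 - n / (2 * s)) * peak n s σ ω ^ (2 * σ + 2) / ω := by
  set q := 1 - n / (2 * s) with hq
  set φ := profile n s σ ω with hφdef
  have hφ := memHs_profile (n := n) (σ := σ) hs hω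
  have hc := peak_pos (n := n) (σ := σ) hs one_pos
  have hρ := peak_pos (n := n) (σ := σ) hs hω
  set c := peak n s σ 1
  set ρ := peak n s σ ω with hρdef
  have hpk : ∀ l : ℝ, 0 < l → peak n s σ l ^ (2 * σ) = c ^ (2 * σ) * l ^ q := by
    intro l hl
    rw [peak_eq hs hl, Real.mul_rpow hc.le (by positivity), ← Real.rpow_mul hl.le]
    rw [← hq, div_mul_cancel₀ _ (by positivity)]
  -- The trace deficit of the fixed function `φ_ω`, as a function of `l`, is nonnegative and
  -- vanishes at `l = ω`. Its zero derivative there gives the mass without computing an integral.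
  have hmin : IsLocalMin (fun l : ℝ => quadForm s l φ - ρ ^ 2 * (c ^ (2 * σ) * l ^ q)) ω := by
    filter_upwards [lt_mem_nhds hω] with l hl
    have h1 := norm_apply_zero_sq_mul_le hs hσ hl hφ
    rw [norm_profile_zero hs hω, hpk l hl] at h1
    have h2 := quadForm_profile (n := n) hs hσ hω
    rw [rpow_two_mul_add_two hρ.le hσ, hpk ω hω] at h2
    linarith
  have hd : HasDerivAt (fun l : ℝ => quadForm s l φ - ρ ^ 2 * (c ^ (2 * σ) * l ^ q))
      (1 * mass φ - ρ ^ 2 * (c ^ (2 * σ) * (q * ω ^ (q - 1)))) ω := by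
    unfold quadForm
    exact (((hasDerivAt_id ω).mul_const _).const_add _).sub
      (((Real.hasDerivAt_rpow_const (Or.inl hω.ne')).const_mul _).const_mul _)
  have h := hmin.hasDerivAt_eq_zero hd
  rw [rpow_two_mul_add_two hρ.le hσ, hpk ω hω]
  rw [Real.rpow_sub_one hω.ne'] at h
  field_simp at h ⊢
  linarith

/-! ### Strict convexity and variational stability -/

/-- The excess `F` of `C l^p` over its tangent at `ω` is convex and vanishes only at `ω`, so it
grows at least linearly away from `ω`. This beats the error `η * (1 + l)`, whose growth in `l`
reflects that the mass error is multiplied by an a priori unbounded frequency. -/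
theorem exists_abs_sub_lt_of_rpow_sub_tangent_le {C p κ : ℝ} (hC : 0 < C) (hp : 1 < p)
    (hω : 0 < ω) (hκ : 0 < κ) :
    ∃ η > 0, ∀ l : ℝ, 0 ≤ l →
      C * l ^ p - C * ω ^ p - C * p * ω ^ p / ω * (l - ω) ≤ η * (1 + l) → |l - ω| < κ := by
  -- Keeps `ω - κ` inside the half-line where `F` is convex.
  wlog hκω : κ < ω generalizing κ
  · obtain ⟨η, hη, h⟩ := this (κ := ω / 2) (by positivity) (by linarith)
    exact ⟨η, hη, fun l hl hle => (h l hl hle).trans_le (by push Not at hκω; linarith)⟩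
  set F : ℝ → ℝ := fun l => C * l ^ p - C * ω ^ p - C * p * ω ^ p / ω * (l - ω) with hF
  -- Strict Bernoulli inequality at `l / ω - 1`.
  have hpos : ∀ l, 0 ≤ l → l ≠ ω → 0 < F l := by
    intro l hl hne
    have h1 := one_add_mul_self_lt_rpow_one_add (s := l / ω - 1) (p := p)
      (by linarith [div_nonneg hl hω.le]) (by
        intro h; apply hne; field_simp at h; linarith) hp
    rw [add_sub_cancel, Real.div_rpow hl hω.le, lt_div_iff₀ (by positivity)] at h1
    have h2 : F l = C * (l ^ p - (1 + p * (l / ω - 1)) * ω ^ p) := by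
      simp only [hF]; field_simp; ring
    rw [h2]
    exact mul_pos hC (by linarith)
  have hconv : ConvexOn ℝ (Ici 0) F := by
    have h1 : ConvexOn ℝ (Ici 0) fun l : ℝ => C * l ^ p := (convexOn_rpow hp.le).smul hC.le
    refine ⟨convex_Ici 0, fun x hx y hy a b ha hb hab => ?_⟩
    have := h1.2 hx hy ha hb hab
    simp only [hF, smul_eq_mul] at this ⊢
    have hb' : b = 1 - a := by linarith
    subst hb'
    nlinarith
  have hFω : F ω = 0 := by simp [hF]
  obtain ⟨m, hm0, hm1, hm2⟩ : ∃ m > 0, m ≤ F (ω + κ) ∧ m ≤ F (ω - κ) :=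
    ⟨min (F (ω + κ)) (F (ω - κ)), lt_min (hpos _ (by linarith) (by linarith))
      (hpos _ (by linarith) (by linarith)), min_le_left _ _, min_le_right _ _⟩
  have hD : 0 < 1 + ω + κ := by positivity
  refine ⟨m / (2 * (1 + ω + κ)), by positivity, fun l hl hle => ?_⟩
  by_contra! hge
  have hle' : F l ≤ m / (2 * (1 + ω + κ)) * (1 + l) := hle
  set d := |l - ω| with hd
  have hd0 : 0 < d := hκ.trans_le hge
  have ht : κ / d ≤ 1 := (div_le_one hd0).2 hge
  -- Convexity on the segment from `ω` to `l`: its point at distance `κ` from `ω` is `ω + κ` or `ω -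
  -- κ`, hence `m ≤ (κ / d) F(l)`.
  have h1 := hconv.2 (mem_Ici.2 hl) (mem_Ici.2 hω.le) (by positivity : 0 ≤ κ / d)
    (sub_nonneg.2 ht) (by ring)
  rw [hFω, smul_zero, add_zero] at h1
  have h2 : m ≤ F ((κ / d) • l + (1 - κ / d) • ω) := by
    have h3 : (κ / d) • l + (1 - κ / d) • ω = ω + κ * ((l - ω) / d) := by
      simp only [smul_eq_mul]; ring
    rw [h3]
    rcases abs_cases (l - ω) with ⟨h, _⟩ | ⟨h, _⟩
    · rw [← h, ← hd, div_self hd0.ne', mul_one]; exact hm1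
    · rw [show l - ω = -d by linarith, neg_div, div_self hd0.ne', mul_neg_one, ← sub_eq_add_neg]
      exact hm2
  have h3 : m * d ≤ κ * F l := by
    have := h2.trans h1
    rwa [smul_eq_mul, div_mul_eq_mul_div, le_div_iff₀ hd0] at this
  have h4 : l ≤ ω + d := by linarith [le_abs_self (l - ω)]
  have h5 : κ * (1 + l) ≤ d * (1 + ω + κ) := by nlinarith
  have h6 : κ * F l ≤ m * d / 2 := by
    calc κ * F l ≤ κ * (m / (2 * (1 + ω + κ)) * (1 + l)) := by gcongr
      _ = m / (2 * (1 + ω + κ)) * (κ * (1 + l)) := by ring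
      _ ≤ m / (2 * (1 + ω + κ)) * (d * (1 + ω + κ)) := by gcongr
      _ = m * d / 2 := by field_simp
  nlinarith [mul_pos hm0 hd0]

/-- Functions whose mass and energy are close to those of the profile have a value at the origin
of modulus close to its peak. -/
theorem abs_norm_apply_zero_sub_peak_lt (hn : 1 ≤ n) (hω : 0 < ω) (hs : (n : ℝ) / 2 < s)
    (hσ : 0 < σ) (hσs : σ < 2 * s / (n : ℝ) - 1) {γ : ℝ} (hγ : 0 < γ) :
    ∃ η > 0, ∀ f : Rn n → ℂ, MemHs s f →
      |energy s σ f - energy s σ (profile n s σ ω)| ≤ η →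
      |mass f - mass (profile n s σ ω)| ≤ η → |‖f 0‖ - peak n s σ ω| < γ := by
  have hn0 : (0 : ℝ) < n := by exact_mod_cast hn
  have hs0 : 0 < s := lt_of_le_of_lt (by positivity) hs
  have hc := peak_pos (n := n) (σ := σ) hs one_pos
  set c := peak n s σ 1
  have hq : 0 < 1 - n / (2 * s) := by
    rw [sub_pos, div_lt_one (by positivity)]; linarith
  set a := (1 - n / (2 * s)) / (2 * σ) with ha
  have ha0 : 0 < a := by positivity
  set p := a * (2 * σ + 2) with hp
  -- Here `p = (1 - n/(2s))(σ + 1)/σ`, and `p > 1` amounts to `(σ + 1) n < 2s`.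
  have hp1 : 1 < p := by
    have h1 : (σ + 1) * n < 2 * s := by
      have : σ + 1 < 2 * s / n := by linarith
      rwa [lt_div_iff₀ hn0] at this
    rw [hp, ha, div_mul_eq_mul_div, lt_div_iff₀ (by positivity), one_sub_div (by positivity),
      div_mul_eq_mul_div, lt_div_iff₀ (by positivity)]
    nlinarith
  set C := σ / (σ + 1) * c ^ (2 * σ + 2) with hCdef
  have hC : 0 < C := by positivity
  have hCl : ∀ l : ℝ, 0 ≤ l → σ / (σ + 1) * (c * l ^ a) ^ (2 * σ + 2) = C * l ^ p := by
    intro l hl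
    rw [Real.mul_rpow hc.le (by positivity), ← Real.rpow_mul hl, hCdef, hp]; ring
  have hcont : ContinuousAt (fun l : ℝ => c * l ^ a) ω :=
    (Real.continuousAt_rpow_const _ _ (Or.inr ha0.le)).const_mul c
  obtain ⟨κ, hκ, hκγ⟩ := Metric.continuousAt_iff.1 hcont γ hγ
  obtain ⟨η, hη, hconv⟩ := exists_abs_sub_lt_of_rpow_sub_tangent_le hC hp1 hω hκ
  refine ⟨η / 2, by positivity, fun f hf hE hM => ?_⟩
  -- The frequency whose peak is `‖f 0‖`.
  set l := (‖f 0‖ / c) ^ a⁻¹ with hl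
  have hl0 : 0 ≤ l := by positivity
  have hr : ‖f 0‖ = c * l ^ a := by
    rw [hl, Real.rpow_inv_rpow (by positivity) ha0.ne']; field_simp
  have h1 := action_lower_bound hs hσ ha0 hl0 hf hr
  have h2 := action_profile (n := n) hs hσ hω
  have h3 := mass_profile (n := n) hs hσ hω
  rw [hr, hCl l hl0] at h1
  -- The slope of the minimal action at `ω` is the mass of the profile.
  have h4 : C * p * ω ^ p / ω = mass (profile n s σ ω) := by
    have haq : 1 - n / (2 * s) = a * (2 * σ) := by rw [ha]; field_simp
    rw [h3, peak_eq hs hω, ← ha, mul_right_comm C, ← hCl ω hω.le, haq, hp]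
    change σ / (σ + 1) * (c * ω ^ a) ^ (2 * σ + 2) * (a * (2 * σ + 2)) / ω
      = a * (2 * σ) * (c * ω ^ a) ^ (2 * σ + 2) / ω
    generalize (c * ω ^ a) ^ (2 * σ + 2) = X
    field_simp
  rw [peak_eq hs hω, ← ha, hCl ω hω.le] at h2
  have h5 : |l - ω| < κ := by
    apply hconv l hl0
    rw [h4]
    have := (abs_le.1 hE).2
    have := mul_le_mul_of_nonneg_left (abs_le.1 hM).2 hl0
    nlinarith
  have := hκγ (Real.dist_eq l ω ▸ h5)
  rwa [Real.dist_eq, ← hr, ← peak_eq hs hω] at this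

/-- Variational stability: closeness in mass and energy implies closeness to the orbit. -/
theorem exists_hsNorm_sub_rotProfile_lt (hn : 1 ≤ n) (hω : 0 < ω) (hs : (n : ℝ) / 2 < s)
    (hσ : 0 < σ) (hσs : σ < 2 * s / (n : ℝ) - 1) {ε : ℝ} (hε : 0 < ε) :
    ∃ η > 0, ∀ f : Rn n → ℂ, MemHs s f →
      |energy s σ f - energy s σ (profile n s σ ω)| ≤ η →
      |mass f - mass (profile n s σ ω)| ≤ η →
      ∃ α : ℝ, hsNorm s (f - rotProfile n s σ ω α) < ε := by
  have hφ := memHs_profile (n := n) (σ := σ) hs hω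
  have hρ := peak_pos (n := n) (σ := σ) hs hω
  set φ := profile n s σ ω with hφdef
  set ρ := peak n s σ ω with hρdef
  -- A bound for the distance to the orbit in terms of energy, mass and `‖f 0‖` alone: the first
  -- term controls `f - z • φ`, the second the distance from `z` to the unit circle. It is
  -- continuous and vanishes at the data of the profile.
  set B : ℝ × ℝ × ℝ → ℝ := fun x =>
    √(2 * x.1 + ω * x.2.1 + x.2.2 ^ (2 * σ + 2) / (σ + 1) - x.2.2 ^ 2 * ρ ^ (2 * σ))
      * (1 + 1 / √ω) + |x.2.2 / ρ - 1| * hsNorm s φ with hB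
  have hBcont : Continuous B := by
    have : Continuous fun x : ℝ × ℝ × ℝ => x.2.2 ^ (2 * σ + 2) :=
      continuous_snd.snd.rpow_const fun _ => Or.inr (by positivity)
    fun_prop
  have hB0 : B (energy s σ φ, mass φ, ρ) = 0 := by
    have h1 := quadForm_eq_energy (s := s) (l := ω) hσ φ
    rw [quadForm_profile hs hσ hω, norm_profile_zero hs hω, rpow_two_mul_add_two hρ.le hσ] at h1
    simp only [hB, rpow_two_mul_add_two hρ.le hσ]
    rw [← h1]
    simp [div_self hρ.ne']
  obtain ⟨γ, hγ, hBγ⟩ := Metric.continuous_iff.1 hBcont (energy s σ φ, mass φ, ρ) ε hε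
  obtain ⟨η, hη, hval⟩ := abs_norm_apply_zero_sub_peak_lt hn hω hs hσ hσs hγ
  refine ⟨min η (γ / 2), lt_min hη (by positivity), fun f hf hE hM => ?_⟩
  have hr := hval f hf (hE.trans (min_le_left _ _)) (hM.trans (min_le_left _ _))
  have hBf := hBγ (energy s σ f, mass f, ‖f 0‖) (by
    simp only [Prod.dist_eq, Real.dist_eq, max_lt_iff]
    exact ⟨hE.trans_lt ((min_le_right _ _).trans_lt (by linarith)),
      hM.trans_lt ((min_le_right _ _).trans_lt (by linarith)), hr⟩)
  rw [Real.dist_eq, hB0, sub_zero] at hBf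
  -- With the phase of `f 0`, the numbers `e` and `z` lie on one ray, so `‖e - z‖` depends only on
  -- `‖f 0‖`.
  refine ⟨(f 0).arg, ?_⟩
  rw [rotProfile_eq]
  set e := Complex.exp (Complex.I * ((f 0).arg : ℂ)) with he
  set z := f 0 / (ρ : ℂ) with hz
  have hsplit : f - e • φ = (f - z • φ) - (e - z) • φ := by
    rw [sub_smul]; abel
  have hnorm : ‖e - z‖ = |‖f 0‖ / ρ - 1| := by
    have h1 : e - z = -(((‖f 0‖ / ρ - 1 : ℝ) : ℂ) * e) := by
      have h2 : z = (‖f 0‖ : ℂ) * e / ρ := by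
        rw [hz, he, mul_comm Complex.I, Complex.norm_mul_exp_arg_mul_I]
      rw [h2]; push_cast; ring
    rw [h1, norm_neg, norm_mul, Complex.norm_real, Real.norm_eq_abs, he, mul_comm Complex.I,
      Complex.norm_exp_ofReal_mul_I, mul_one]
  have h1 := hsNorm_sub_smul_le (hf.sub_smul hφ z) hφ (e - z)
  have h2 := hsNorm_le_sqrt_quadForm hω (hf.sub_smul hφ z)
  rw [quadForm_sub_smul_profile hs hσ hω hf, quadForm_eq_energy hσ f] at h2
  rw [hsplit]
  rw [hnorm] at h1
  exact (h1.trans (add_le_add_left h2 _)).trans_lt ((le_abs_self _).trans_lt hBf)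

/-- Continuity of the mass and of the energy on `H^s`. -/
theorem exists_energy_mass_sub_le (hs : (n : ℝ) / 2 < s) (hσ : 0 < σ) {f : Rn n → ℂ}
    (hf : MemHs s f) {η : ℝ} (hη : 0 < η) :
    ∃ δ > 0, ∀ g : Rn n → ℂ, MemHs s g → hsNorm s (g - f) < δ →
      |energy s σ g - energy s σ f| ≤ η ∧ |mass g - mass f| ≤ η := by
  -- The trace bound makes evaluation at `0`, hence the nonlinear part of the energy, continuous on
  -- `H^s`.
  obtain ⟨C, hC, htr⟩ := norm_apply_zero_le (n := n) hs
  have hcE : Continuous fun x : ℝ × ℝ =>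
      1 / 2 * x.1 ^ 2 - 1 / (2 * σ + 2) * x.2 ^ (2 * σ + 2) := by
    have : Continuous fun x : ℝ × ℝ => x.2 ^ (2 * σ + 2) :=
      continuous_snd.rpow_const fun _ => Or.inr (by positivity)
    fun_prop
  obtain ⟨γ, hγ, hE⟩ := Metric.continuous_iff.1 hcE (‖fracLap (s / 2) f‖, ‖f 0‖) η hη
  obtain ⟨ν, hν, hM⟩ := Metric.continuous_iff.1 (continuous_pow 2 (M := ℝ))
    (eLpNorm f 2 volume).toReal η hη
  refine ⟨min (min γ (γ / C)) ν, by positivity, fun g hg hlt => ?_⟩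
  rw [lt_min_iff, lt_min_iff] at hlt
  obtain ⟨⟨h1, h2⟩, h3⟩ := hlt
  have hgf : MemHs s (g - f) := by simpa using hg.sub_smul hf 1
  constructor
  · have h4 : |‖g 0‖ - ‖f 0‖| < γ := by
      have h5 := htr _ hgf
      rw [lt_div_iff₀' hC] at h2
      exact (abs_norm_sub_norm_le _ _).trans_lt (h5.trans_lt h2)
    have := hE (‖fracLap (s / 2) g‖, ‖g 0‖) (by
      simp only [Prod.dist_eq, Real.dist_eq, max_lt_iff]
      exact ⟨(abs_norm_fracLap_sub_le hg hf).trans_lt h1, h4⟩)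
    exact this.le
  · have := hM (eLpNorm g 2 volume).toReal ((abs_eLpNorm_sub_le hg hf).trans_lt h3)
    rw [mass_eq_sq hg.2.1, mass_eq_sq hf.2.1]
    exact this.le

end ConcNLS

/-- Only the conservation laws enter: the profile minimizes the action among functions with the same
value at the origin, and strict convexity of the minimal action in the frequency makes closeness of
mass and energy to those of the profile sufficient, uniformly in time. -/
theorem theorem5 (n : ℕ) (hn : 1 ≤ n) (s σ ω : ℝ) (hω : 0 < ω) (hs : (n : ℝ) / 2 < s)
    (hσ : 0 < σ) (hσs : σ < 2 * s / (n : ℝ) - 1)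
    (U : (ConcNLS.Rn n → ℂ) → ℝ → ConcNLS.Rn n → ℂ)
    (hdep : ConcNLS.ContinuousDependence s σ ω U)
    (hglob : ConcNLS.GlobalAndConservative s σ ω U) :
    ConcNLS.OrbitallyStable s σ ω U := by
  intro ε hε
  obtain ⟨r, hr, hglob⟩ := hglob
  obtain ⟨η, hη, hstab⟩ :=
    -- Half of `ε` keeps the inequality strict after the supremum over `t`.
    ConcNLS.exists_hsNorm_sub_rotProfile_lt hn hω hs hσ hσs (half_pos hε)
  obtain ⟨δ, hδ, hcont⟩ :=
    ConcNLS.exists_energy_mass_sub_le hs hσ (ConcNLS.memHs_profile (σ := σ) hs hω) hη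
  refine ⟨min δ r, lt_min hδ hr, fun g hg hlt => ?_⟩
  obtain ⟨hsol, hcons⟩ := hglob g hg (hlt.trans_le (min_le_right _ _))
  obtain ⟨hE, hM⟩ := hcont g hg (hlt.trans_le (min_le_left _ _))
  refine ⟨hsol, lt_of_le_of_lt (iSup₂_le fun t ht => ?_)
    ((ENNReal.ofReal_lt_ofReal_iff hε).2 (half_lt_self hε))⟩
  have ht0 : (0 : ℝ) ≤ t := (mem_Ioi.1 ht).le
  obtain ⟨hMt, hEt⟩ := hcons t ht0
  obtain ⟨α, hα⟩ := hstab (U g t) (hsol.memHs t ht0) (hEt ▸ hE) (hMt ▸ hM)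
  -- The free phase `θ` absorbs `ω t`, so the phase `α` may depend on time arbitrarily.
  refine iInf_le_of_le (α - ω * t) (ENNReal.ofReal_le_ofReal ?_)
  rw [add_sub_cancel]
  exact hα.le
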